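/- A quandle is a set $Q$ with a binary operation $*$ such that $x*x=x$ and $x*(y*z)=(x*y)*(x*z)$ for all $x,y,z\in Q$, and such that for all $x,y\in Q$ there is a unique $z\in Q$ with $x*z=y$. For an abelian group $(A,+)$ and an automorphism $f$ of $A$, the affine quandle $\mathrm{Aff}(A,f)$ is the set $A$ with the operation $a*b=a-f(a)+f(b)$. A quandle is called quasi-affine if it is isomorphic to a subquandle of some affine quandle $\mathrm{Aff}(A,f)$ (where $A$ may be infinite). Let $p>2$ be a prime. Then, up to isomorphism, there are exactly $(3p-1)/2$ quasi-affine quandles of order $2p$. -/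

import Mathlib

open scoped Quandles

universe u

/-- The underlying type of the affine quandle `Aff(A, f)`, for an abelian group `A` and an
automorphism `f` of `A`. -/
def Aff (A : Type u) [AddCommGroup A] (_f : A ≃+ A) : Type u := A

/-- The affine quandle `Aff(A, f)`: the set `A` with `a * b = (1 - f)(a) + f(b)`. -/
instance Aff.instQuandle (A : Type u) [AddCommGroup A] (f : A ≃+ A) : Quandle (Aff A f) where
  act := fun (a b : A) => (a - f a) + f b
  self_distrib := by
    intro (x : A) (y : A) (z : A)
    change (x - f x) + f ((y - f y) + f z) =
      (((x - f x) + f y) - f ((x - f x) + f y)) + f ((x - f x) + f z)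
    simp only [map_add, map_sub]
    abel
  invAct := fun (a c : A) => f.symm (c - (a - f a))
  left_inv := by
    intro (x : A) (y : A)
    change f.symm ((x - f x) + f y - (x - f x)) = y
    simp
  right_inv := by
    intro (x : A) (y : A)
    change (x - f x) + f (f.symm (y - (x - f x))) = y
    simp
  fix := by
    intro (x : A)
    change (x - f x) + f x = x
    simp

/-- A quandle is quasi-affine if it embeds into an affine quandle. -/
def IsQuasiAffine (Q : Type u) [Quandle Q] : Prop :=
  ∃ (A : Type u) (_ : AddCommGroup A) (f : A ≃+ A) (φ : Q →◃ Aff A f), Function.Injective φ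

/-- Two quandles are isomorphic. -/
def QuandleIsomorphic (Q R : Type u) [Quandle Q] [Quandle R] : Prop :=
  ∃ e : Q ≃ R, ∀ x y : Q, e (x ◃ y) = e x ◃ e y

/-- Bundled quasi-affine quandles of order `n` (in the universe `u`). For `n = 0` the condition
`Nat.card carrier = n` would also admit infinite quandles, hence the field `finite`. -/
structure QuasiAffineQuandle (n : ℕ) : Type (u + 1) where
  carrier : Type u
  quandle : Quandle carrier
  finite : Finite carrier
  card_eq : Nat.card carrier = n
  quasiAffine : IsQuasiAffine carrier

attribute [instance] QuasiAffineQuandle.quandle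

/-- The isomorphism relation on quasi-affine quandles of order `n`. -/
instance QuasiAffineQuandle.isoSetoid (n : ℕ) : Setoid (QuasiAffineQuandle.{u} n) where
  r Q R := QuandleIsomorphic Q.carrier R.carrier
  iseqv :=
    { refl := fun _ => ⟨Equiv.refl _, fun _ _ => rfl⟩
      symm := by
        rintro Q R ⟨e, he⟩
        refine ⟨e.symm, fun x y => e.injective ?_⟩
        rw [he]
        simp
      trans := by
        rintro Q R S ⟨e, he⟩ ⟨g, hg⟩
        exact ⟨e.trans g, fun x y => by simp [he, hg]⟩ }

/-- The isomorphism classes of quasi-affine quandles of order `n`. -/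
def QuasiAffineQuandle.IsoClass (n : ℕ) : Type (u + 1) :=
  Quotient (QuasiAffineQuandle.isoSetoid.{u} n)

/-! Let `φ` embed `Q` in `Aff A f`, and let `D` be generated by all (1 - f)(φ x - φ y). Translations
by `D` preserve the image of `Q`, which is therefore a union of cosets of `D`: a mesh with one fibre
per coset (`IsQuasiAffine.exists_equiv_affineMesh`). Conversely, every mesh is quasi-affine
(`AffineMesh.isQuasiAffine`).

In order 2p, |D| divides 2p. |D| = 2p would make 1 - f bijective on `D`, which is impossible
(`not_surjective_sub_of_card_eq_two_mul`), and |D| = 1 gives the projection quandle. If |D| = 2,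
then f = 1 and only the number of fibres with shift 1 matters, up to complement: (p + 1)/2 classes,
projection included. If |D| = p, then f is multiplication by a unit, which determines the
non-projection quandle: p - 1 classes. Fixed-point counts, orders of displacements and conjugation
of displacements separate the models. -/

/-! ### Affine meshes -/

/-- The quandle on `D × I` whose fibres over `I` are copies of `Aff D f`, shifted against each
other by the constants `e i - e j`. -/
def AffineMesh {D : Type*} {I : Type*} [AddCommGroup D] (_f : D ≃+ D) (_e : I → D) := D × I

namespace AffineMesh

variable {D D' I I' : Type*} [AddCommGroup D] [AddCommGroup D']

instance instQuandle (f : D ≃+ D) (e : I → D) : Quandle (AffineMesh f e) where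
  act := fun (x y : D × I) => (x.1 - f x.1 + f y.1 + e x.2 - e y.2, y.2)
  self_distrib := by
    rintro ⟨a, i⟩ ⟨b, j⟩ ⟨c, k⟩
    refine Prod.ext ?_ rfl
    simp only [map_add, map_sub]
    abel
  invAct := fun (x y : D × I) => (f.symm (y.1 - (x.1 - f x.1) - e x.2 + e y.2), y.2)
  left_inv := by
    rintro ⟨a, i⟩ ⟨b, j⟩
    refine Prod.ext ?_ rfl
    simp only [AddEquiv.symm_apply_eq]
    abel
  right_inv := by
    rintro ⟨a, i⟩ ⟨b, j⟩
    refine Prod.ext ?_ rfl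
    simp only [AddEquiv.apply_symm_apply]
    abel
  fix := by
    rintro ⟨a, i⟩
    refine Prod.ext ?_ rfl
    simp

/-- The point of the fibre over `i` with coordinate `a`. -/
def mk (f : D ≃+ D) (e : I → D) (a : D) (i : I) : AffineMesh f e := (a, i)

theorem mk_act_mk (f : D ≃+ D) (e : I → D) (a b : D) (i j : I) :
    mk f e a i ◃ mk f e b j = mk f e (a - f a + f b + e i - e j) j := rfl

theorem mk_invAct_mk (f : D ≃+ D) (e : I → D) (a b : D) (i j : I) :
    mk f e a i ◃⁻¹ mk f e b j = mk f e (f.symm (b - (a - f a) - e i + e j)) j := rfl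

theorem mk_inj {f : D ≃+ D} {e : I → D} {a b : D} {i j : I} :
    mk f e a i = mk f e b j ↔ a = b ∧ i = j := Prod.mk_inj

theorem act_eq {f : D ≃+ D} {e : I → D} (hf : ∀ a, f a = a) (he : ∀ i j, e i = e j)
    (x y : AffineMesh f e) : x ◃ y = y := by
  obtain ⟨a, i⟩ := x
  obtain ⟨b, j⟩ := y
  change mk f e (a - f a + f b + e i - e j) j = mk f e b j
  rw [hf, hf, he i j, sub_self, zero_add, add_sub_cancel_right]

theorem mk_act_mk_invAct_mk (f : D ≃+ D) (e : I → D) (a b c : D) (i j k : I) :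
    mk f e a i ◃ (mk f e b j ◃⁻¹ mk f e c k) =
      mk f e (c + (a - b - f (a - b) + e i - e j)) k := by
  rw [mk_invAct_mk, mk_act_mk, mk_inj]
  refine ⟨?_, rfl⟩
  simp only [AddEquiv.apply_symm_apply, map_sub]
  abel

theorem iterate_act_invAct_mk (f : D ≃+ D) (e : I → D) (a b c : D) (i j k : I) (n : ℕ) :
    (fun z => mk f e a i ◃ (mk f e b j ◃⁻¹ z))^[n] (mk f e c k) =
      mk f e (c + n • (a - b - f (a - b) + e i - e j)) k := by
  induction n generalizing c with
  | zero => simp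
  | succ n ih =>
    rw [Function.iterate_succ_apply, mk_act_mk_invAct_mk, ih, succ_nsmul', add_assoc]

theorem card_eq (f : D ≃+ D) (e : I → D) :
    Nat.card (AffineMesh f e) = Nat.card D * Nat.card I :=
  Nat.card_prod D I

instance instFinite [Finite D] [Finite I] (f : D ≃+ D) (e : I → D) : Finite (AffineMesh f e) :=
  inferInstanceAs (Finite (D × I))

/-- The automorphism of `D × (I →₀ ℤ)` for which `1 - F` maps the `i`-th basis vector to `e i`. -/
noncomputable def extension (f : D ≃+ D) (e : I → D) : (D × (I →₀ ℤ)) ≃+ (D × (I →₀ ℤ)) where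
  toFun x := (f x.1 - Finsupp.liftAddHom (fun i => (zmultiplesHom D) (e i)) x.2, x.2)
  invFun x := (f.symm (x.1 + Finsupp.liftAddHom (fun i => (zmultiplesHom D) (e i)) x.2), x.2)
  left_inv := by rintro ⟨a, v⟩; refine Prod.ext ?_ rfl; simp
  right_inv := by rintro ⟨a, v⟩; refine Prod.ext ?_ rfl; simp
  map_add' := by
    rintro ⟨a, v⟩ ⟨b, w⟩
    refine Prod.ext ?_ rfl
    simp only [Prod.fst_add, Prod.snd_add, map_add]
    abel

/-- The shift `e i` need not lie in (1 - f)D. One free generator per fibre supplies a preimage, and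
the fibre becomes the coset of that generator. -/
theorem isQuasiAffine (f : D ≃+ D) (e : I → D) : IsQuasiAffine (AffineMesh f e) := by
  refine ⟨D × (I →₀ ℤ), inferInstance, extension f e,
    ⟨fun x => ((x.1, Finsupp.single x.2 1) : D × (I →₀ ℤ)), ?_⟩, ?_⟩
  · rintro ⟨a, i⟩ ⟨b, j⟩
    change ((a - f a + f b + e i - e j, Finsupp.single j 1) : D × (I →₀ ℤ)) =
      ((a, Finsupp.single i 1) - extension f e (a, Finsupp.single i 1)) +
        extension f e (b, Finsupp.single j 1)
    refine Prod.ext ?_ ?_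
    · simp [extension]
      abel
    · simp [extension]
  · rintro ⟨a, i⟩ ⟨b, j⟩ h
    have h' : ((a, Finsupp.single i 1) : D × (I →₀ ℤ)) = (b, Finsupp.single j 1) := h
    rw [Prod.mk.injEq] at h'
    exact Prod.ext h'.1 (Finsupp.single_left_injective one_ne_zero h'.2)

/-- Moving the origin of fibre `i` to `c i` changes its shift by (1 - f)(c i), and only differences
of shifts enter the operation. -/
theorem exists_equiv {f : D ≃+ D} {e : I → D} {f' : D' ≃+ D'} {e' : I' → D'}
    (ψ : D ≃+ D') (σ : I ≃ I') (c : I → D) (hf : ∀ a, ψ (f a) = f' (ψ a))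
    (he : ∀ i j, e' (σ i) - e' (σ j) = ψ (e i - e j + (c i - f (c i)) - (c j - f (c j)))) :
    ∃ E : AffineMesh f e ≃ AffineMesh f' e', ∀ x y, E (x ◃ y) = E x ◃ E y := by
  refine ⟨⟨fun x => (ψ (x.1 - c x.2), σ x.2),
    fun x => (ψ.symm x.1 + c (σ.symm x.2), σ.symm x.2), ?_, ?_⟩, ?_⟩
  · rintro ⟨a, i⟩; refine Prod.ext ?_ ?_ <;> simp
  · rintro ⟨a, i⟩; refine Prod.ext ?_ ?_ <;> simp
  · rintro ⟨a, i⟩ ⟨b, j⟩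
    change ((ψ (a - f a + f b + e i - e j - c j), σ j) : D' × I') =
      (ψ (a - c i) - f' (ψ (a - c i)) + f' (ψ (b - c j)) + e' (σ i) - e' (σ j), σ j)
    refine Prod.ext ?_ rfl
    simp only
    rw [add_sub_assoc _ (e' (σ i)), he, ← hf, ← hf, ← map_sub, ← map_add, ← map_add]
    congr 1
    simp only [map_sub]
    abel

end AffineMesh

/-! ### Displacement group and mesh decomposition -/

section Displacement

variable {Q A : Type*} [AddCommGroup A]

/-- The translations of `A` induced by the displacement group of a quandle `Q` embedded by `φ`
into `Aff A f`. -/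
def displacementSubgroup (f : A ≃+ A) (φ : Q → A) : AddSubgroup A :=
  AddSubgroup.closure {d | ∃ x y, d = (φ x - φ y) - f (φ x - φ y)}

theorem sub_mem_displacementSubgroup {f : A ≃+ A} {φ : Q → A} (x y : Q) :
    (φ x - φ y) - f (φ x - φ y) ∈ displacementSubgroup f φ :=
  AddSubgroup.subset_closure ⟨x, y, rfl⟩

variable [Quandle Q] {f : A ≃+ A} {φ : Q → A}

/-- Since f(φ x - φ y) = φ(x ◃ x) - φ(x ◃ y), generators go to generators. -/
theorem map_mem_displacementSubgroup
    (hφ : ∀ x y, φ (x ◃ y) = φ x - f (φ x) + f (φ y)) {d : A} (hd : d ∈ displacementSubgroup f φ) :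
    f d ∈ displacementSubgroup f φ := by
  induction hd using AddSubgroup.closure_induction with
  | mem d hd =>
    obtain ⟨x, y, rfl⟩ := hd
    have h : f (φ x - φ y) = φ (x ◃ x) - φ (x ◃ y) := by rw [hφ, hφ, map_sub]; abel
    rw [map_sub, h]
    exact sub_mem_displacementSubgroup _ _
  | zero => simp [zero_mem]
  | add a b _ _ ha hb => rw [map_add]; exact add_mem ha hb
  | neg a _ ha => rw [map_neg]; exact neg_mem ha

theorem map_invAct_of_map_act
    (hφ : ∀ x y, φ (x ◃ y) = φ x - f (φ x) + f (φ y)) (x y : Q) :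
    φ (x ◃⁻¹ y) = f.symm (φ y - (φ x - f (φ x))) := by
  have h := hφ x (x ◃⁻¹ y)
  rw [Rack.act_invAct_eq] at h
  rw [h, add_sub_cancel_left, AddEquiv.symm_apply_apply]

theorem symm_mem_displacementSubgroup
    (hφ : ∀ x y, φ (x ◃ y) = φ x - f (φ x) + f (φ y)) {d : A} (hd : d ∈ displacementSubgroup f φ) :
    f.symm d ∈ displacementSubgroup f φ := by
  induction hd using AddSubgroup.closure_induction with
  | mem d hd =>
    obtain ⟨x, y, rfl⟩ := hd
    have h : f.symm (φ x - φ y) = φ (x ◃⁻¹ x) - φ (x ◃⁻¹ y) := by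
      rw [map_invAct_of_map_act hφ, map_invAct_of_map_act hφ, ← map_sub]; congr 1; abel
    have h2 : f.symm (φ x - φ y - f (φ x - φ y)) =
        f.symm (φ x - φ y) - f (f.symm (φ x - φ y)) := by simp
    rw [h2, h]
    exact sub_mem_displacementSubgroup _ _
  | zero => simp [zero_mem]
  | add a b _ _ ha hb => rw [map_add]; exact add_mem ha hb
  | neg a _ ha => rw [map_neg]; exact neg_mem ha

theorem exists_eq_add_of_mem_displacementSubgroup
    (hφ : ∀ x y, φ (x ◃ y) = φ x - f (φ x) + f (φ y)) {d : A}
    (hd : d ∈ displacementSubgroup f φ) (x : Q) : ∃ y, φ y = φ x + d := by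
  have step (y z x : Q) : φ (y ◃ (z ◃⁻¹ x)) = φ x + (φ y - φ z - f (φ y - φ z)) := by
    rw [hφ, map_invAct_of_map_act hφ, AddEquiv.apply_symm_apply, map_sub]
    abel
  -- With both signs carried along, negation merely swaps the two halves.
  suffices h : ∀ x, (∃ y, φ y = φ x + d) ∧ ∃ y, φ y = φ x - d from (h x).1
  induction hd using AddSubgroup.closure_induction with
  | mem d hd =>
    obtain ⟨y, z, rfl⟩ := hd
    refine fun x => ⟨⟨_, step y z x⟩, ⟨z ◃ (y ◃⁻¹ x), ?_⟩⟩
    rw [step, map_sub, map_sub]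
    abel
  | zero => exact fun x => ⟨⟨x, by simp⟩, ⟨x, by simp⟩⟩
  | add a b _ _ ha hb =>
    intro x
    obtain ⟨y, hy⟩ := (ha x).1
    obtain ⟨z, hz⟩ := (hb y).1
    obtain ⟨y', hy'⟩ := (ha x).2
    obtain ⟨z', hz'⟩ := (hb y').2
    exact ⟨⟨z, by rw [hz, hy, add_assoc]⟩, ⟨z', by rw [hz', hy', sub_sub]⟩⟩
  | neg a _ ha =>
    intro x
    refine ⟨?_, ?_⟩
    · simpa [sub_eq_add_neg] using (ha x).2
    · simpa using (ha x).1

/-- Every quasi-affine quandle is a mesh over its displacement group, indexed by the orbits. -/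
theorem IsQuasiAffine.exists_equiv_affineMesh {Q : Type u} [Quandle Q] [Nonempty Q]
    (hQ : IsQuasiAffine Q) :
    ∃ (D I : Type u) (_ : AddCommGroup D) (f : D ≃+ D) (e : I → D),
      (∃ E : AffineMesh f e ≃ Q, ∀ x y, E (x ◃ y) = E x ◃ E y) ∧
      (Subsingleton I → Function.Surjective fun d => d - f d) := by
  obtain ⟨A, _, f, Φ, hΦ⟩ := hQ
  obtain ⟨φ, hφ, hinj⟩ : ∃ φ : Q → A, (∀ x y, φ (x ◃ y) = φ x - f (φ x) + f (φ y)) ∧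
      Function.Injective φ := ⟨Φ, fun x y => Φ.map_act, hΦ⟩
  let r : Setoid Q := (QuotientAddGroup.leftRel (displacementSubgroup f φ)).comap φ
  have hr (x y : Q) : r x y ↔ -φ x + φ y ∈ displacementSubgroup f φ :=
    QuotientAddGroup.leftRel_apply
  let q : Quotient r → Q := Quotient.out
  let g : displacementSubgroup f φ ≃+ displacementSubgroup f φ :=
    { toFun := fun d => ⟨f d, map_mem_displacementSubgroup hφ d.2⟩
      invFun := fun d => ⟨f.symm d, symm_mem_displacementSubgroup hφ d.2⟩
      left_inv := fun d => by simp
      right_inv := fun d => by simp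
      map_add' := fun a b => by simp }
  let x₀ : Q := Classical.arbitrary Q
  -- Subtracting the base point `x₀` brings the shift into `D`; it cancels in differences.
  let e : Quotient r → displacementSubgroup f φ := fun i =>
    ⟨_, sub_mem_displacementSubgroup (q i) x₀⟩
  choose t ht using fun (d : displacementSubgroup f φ) (x : Q) =>
    exists_eq_add_of_mem_displacementSubgroup hφ d.2 x
  refine ⟨displacementSubgroup f φ, Quotient r, inferInstance, g, e,
    ⟨Equiv.ofBijective (fun x => t x.1 (q x.2)) ⟨?_, ?_⟩, ?_⟩, ?_⟩
  · rintro ⟨a, i⟩ ⟨b, j⟩ (h : t a (q i) = t b (q j))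
    have h2 := congrArg φ h
    rw [ht, ht] at h2
    have hij : i = j := by
      rw [← Quotient.out_eq i, ← Quotient.out_eq j]
      refine Quotient.sound ((hr _ _).2 ?_)
      have h3 : -φ (q i) + φ (q j) = a - b := by
        rw [eq_sub_of_add_eq h2]; abel
      exact h3 ▸ sub_mem a.2 b.2
    subst hij
    exact Prod.ext (Subtype.ext (add_left_cancel h2)) rfl
  · intro x
    have hx : r (q ⟦x⟧) x := Quotient.mk_out x
    refine ⟨(⟨_, (hr _ _).1 hx⟩, ⟦x⟧), hinj ?_⟩
    simp [ht]
  · rintro ⟨a, i⟩ ⟨b, j⟩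
    refine hinj ?_
    change φ (t (a - g a + g b + e i - e j) (q j)) = φ (t a (q i) ◃ t b (q j))
    rw [hφ, ht, ht, ht]
    simp only [AddSubgroup.coe_add, AddSubgroup.coe_sub, g, e, AddEquiv.coe_mk, Equiv.coe_fn_mk,
      map_add, map_sub]
    abel
  -- With a single coset, φ x - φ y itself lies in `D`, so each generator is in (1 - f)D.
  · intro hI d
    obtain ⟨d, hd⟩ := d
    induction hd using AddSubgroup.closure_induction with
    | mem d hd =>
      obtain ⟨x, y, rfl⟩ := hd
      have hxy : r y x := Quotient.exact (Subsingleton.elim (⟦y⟧ : Quotient r) ⟦x⟧)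
      exact ⟨⟨_, (hr _ _).1 hxy⟩, Subtype.ext (by simp [g, neg_add_eq_sub])⟩
    | zero => exact ⟨0, Subtype.ext (by simp)⟩
    | add a b _ _ ha hb =>
      obtain ⟨a', ha'⟩ := ha
      obtain ⟨b', hb'⟩ := hb
      refine ⟨a' + b', Subtype.ext ?_⟩
      have h := congrArg Subtype.val (congrArg₂ (· + ·) ha' hb')
      simp only [map_add] at h ⊢
      rw [add_sub_add_comm]
      exact h
    | neg a _ ha =>
      obtain ⟨a', ha'⟩ := ha
      refine ⟨-a', Subtype.ext ?_⟩
      have h := congrArg Subtype.val (congrArg (- ·) ha')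
      simp only [map_neg] at h ⊢
      rw [sub_neg_eq_add, neg_add_eq_sub]
      simpa using h

end Displacement

theorem map_invAct_of_equiv {Q R : Type*} [Quandle Q] [Quandle R] {E : Q ≃ R}
    (hE : ∀ x y, E (x ◃ y) = E x ◃ E y) (x y : Q) : E (x ◃⁻¹ y) = E x ◃⁻¹ E y := by
  rw [← Rack.left_cancel (E x), ← hE, Rack.act_invAct_eq, Rack.act_invAct_eq]

theorem exists_equiv_of_act_eq {Q R : Type*} [Quandle Q] [Quandle R] [Finite Q] [Finite R]
    (hQ : ∀ x y : Q, x ◃ y = y) (hR : ∀ x y : R, x ◃ y = y) (h : Nat.card Q = Nat.card R) :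
    ∃ E : Q ≃ R, ∀ x y, E (x ◃ y) = E x ◃ E y :=
  ⟨(Finite.card_eq.1 h).some, fun x y => by rw [hQ, hR]⟩

theorem exists_equiv_iff_of_card_eq {I J : Type*} [Finite I] [Finite J] (P : I → Prop)
    (R : J → Prop) (h : Nat.card I = Nat.card J)
    (hP : Nat.card {i // P i} = Nat.card {j // R j}) : ∃ σ : I ≃ J, ∀ i, P i ↔ R (σ i) := by
  classical
  obtain ⟨τ⟩ := Finite.card_eq.1 h
  obtain ⟨ρ⟩ := Finite.card_eq.1 hP
  let ρ' : {i // P i} ≃ {i // R (τ i)} :=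
    ρ.trans (τ.subtypeEquiv fun _ => Iff.rfl).symm
  cases nonempty_fintype I
  refine ⟨ρ'.extendSubtype.trans τ, fun i => ⟨fun hi => ρ'.extendSubtype_mem i hi, fun hi => ?_⟩⟩
  by_contra hn
  exact ρ'.extendSubtype_not_mem i hn hi

/-- A group of squarefree order 2p is cyclic, so its only involution is fixed by `f` and killed by 1
- f, which cannot then be injective. -/
theorem not_surjective_sub_of_card_eq_two_mul {D : Type*} [AddCommGroup D] {p : ℕ}
    (hp : p.Prime) (hp2 : 2 < p) (hD : Nat.card D = 2 * p) (f : D ≃+ D) :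
    ¬ Function.Surjective fun d => d - f d := by
  classical
  intro hs
  have hfin : Finite D := Nat.finite_of_card_ne_zero (by rw [hD]; have := hp.pos; positivity)
  have hinj := Finite.injective_iff_surjective.2 hs
  have hsq : Squarefree (2 * p) := (Nat.squarefree_mul
    ((Nat.coprime_primes Nat.prime_two hp).2 hp2.ne)).2 ⟨Nat.prime_two.squarefree, hp.squarefree⟩
  have hZ : IsZGroup (Multiplicative D) := IsZGroup.of_squarefree (by
    rw [Nat.card_congr Multiplicative.toAdd, hD]; exact hsq)
  have hcyc : IsAddCyclic D := isCyclic_multiplicative_iff.1 inferInstance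
  have : Fact (Nat.Prime 2) := ⟨Nat.prime_two⟩
  cases nonempty_fintype D
  obtain ⟨t, ht⟩ := exists_prime_addOrderOf_dvd_card (G := D) 2
    (by rw [← Nat.card_eq_fintype_card, hD]; exact dvd_mul_right 2 p)
  have ht2 : 2 • t = 0 := ht ▸ addOrderOf_nsmul_eq_zero t
  have ht0 : t ≠ 0 := by rintro rfl; simp at ht
  have hle := IsAddCyclic.card_nsmul_eq_zero_le (α := D) (n := 2) two_pos
  have hft0 : f t ≠ 0 := by simpa using ht0
  have htf : t ≠ f t := fun h => ht0 (hinj (by simp [← h]))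
  have hsub : ({0, t, f t} : Finset D) ⊆ Finset.univ.filter fun d => 2 • d = 0 := by
    intro d hd
    simp only [Finset.mem_insert, Finset.mem_singleton] at hd
    rw [Finset.mem_filter]
    refine ⟨Finset.mem_univ _, ?_⟩
    rcases hd with rfl | rfl | rfl
    · simp
    · exact ht2
    · rw [← map_nsmul, ht2, map_zero]
  have h3 := Finset.card_le_card hsub
  rw [Finset.card_eq_three.2 ⟨0, t, f t, ht0.symm, hft0.symm, htf, rfl⟩] at h3
  omega

/-! ### Models and reduction to them -/

/-- The bundled quasi-affine quandle given by a mesh. -/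
def AffineMesh.toQuasiAffineQuandle {D : Type} {I : Type u} [AddCommGroup D] [Finite D] [Finite I]
    (f : D ≃+ D) (e : I → D) {n : ℕ} (h : Nat.card D * Nat.card I = n) :
    QuasiAffineQuandle.{u} n where
  carrier := AffineMesh f e
  quandle := inferInstance
  finite := inferInstance
  card_eq := (AffineMesh.card_eq f e).trans h
  quasiAffine := AffineMesh.isQuasiAffine f e

/-- The shifts equal to `1` on the first `k` of `p` fibres and to `0` on the others. -/
def initialShift (p k : ℕ) (i : ULift.{u} (Fin p)) : ZMod 2 := if i.down.1 < k then 1 else 0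

/-- The shifts `0` and `1` of two fibres. -/
def boolShift (p : ℕ) (i : ULift.{u} Bool) : ZMod p := if i.down then 1 else 0

/-- Multiplication by a unit of `ZMod p`. -/
def unitAut (p : ℕ) (a : (ZMod p)ˣ) : ZMod p ≃+ ZMod p := DistribMulAction.toAddEquiv _ a

theorem unitAut_apply {p : ℕ} (a : (ZMod p)ˣ) (x : ZMod p) : unitAut p a x = a * x := rfl

/-- The quandle with `p` fibres of order two, of which `k` are shifted. -/
abbrev BinaryMesh (p k : ℕ) : Type u := AffineMesh (AddEquiv.refl (ZMod 2)) (initialShift.{u} p k)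

/-- The quandle with two fibres of order `p`, on which the point stabilisers act as multiplication
by `a`. -/
abbrev UnitMesh (p : ℕ) (a : (ZMod p)ˣ) : Type u := AffineMesh (unitAut p a) (boolShift.{u} p)

theorem card_val_lt {p k : ℕ} (hk : k ≤ p) :
    Nat.card {i : ULift.{u} (Fin p) // i.down.1 < k} = k := by
  have e : {i : ULift.{u} (Fin p) // i.down.1 < k} ≃ Fin k :=
    { toFun := fun i => ⟨i.1.down.1, i.2⟩
      invFun := fun j => ⟨⟨⟨j.1, j.2.trans_le hk⟩⟩, j.2⟩
      left_inv := fun _ => rfl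
      right_inv := fun _ => rfl }
  rw [Nat.card_congr e, Nat.card_fin]

theorem card_initialShift_eq_one {p k : ℕ} (hk : k ≤ p) :
    Nat.card {i : ULift.{u} (Fin p) // initialShift p k i = 1} = k := by
  refine (Nat.card_congr (Equiv.subtypeEquivRight fun i => ?_)).trans (card_val_lt.{u} hk)
  unfold initialShift
  split_ifs with h <;> simp [h]

theorem card_eq_zero_add_card_eq_one {I : Type*} [Finite I] (e : I → ZMod 2) :
    Nat.card {i // e i = 0} + Nat.card {i // e i = 1} = Nat.card I := by
  classical
  cases nonempty_fintype I
  have h : ∀ i, e i = 1 ↔ ¬ e i = 0 := fun i => by generalize e i = x; revert x; decide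
  simp only [h, Nat.card_eq_fintype_card]
  rw [Fintype.card_subtype_compl]
  have := Fintype.card_subtype_le fun i => e i = 0
  omega

theorem nonempty_addEquiv_zmod {D : Type*} [AddCommGroup D] {p : ℕ} (hp : p.Prime)
    (hD : Nat.card D = p) : Nonempty (D ≃+ ZMod p) := by
  have : Fact p.Prime := ⟨hp⟩
  have : IsAddCyclic D := isAddCyclic_of_prime_card hD
  exact ⟨(hD ▸ zmodAddCyclicAddEquiv this).symm⟩

theorem addEquiv_eq_of_card_eq_two {D : Type*} [AddCommGroup D] (hD : Nat.card D = 2)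
    (f : D ≃+ D) (a : D) : f a = a := by
  obtain ⟨ψ⟩ := nonempty_addEquiv_zmod Nat.prime_two hD
  have key : ∀ x y : ZMod 2, (x = 0 ↔ y = 0) → x = y := by decide
  exact ψ.injective (key _ _ (by simp))

theorem exists_equiv_binaryMesh {D : Type*} {I : Type u} [AddCommGroup D] [Finite I] {p : ℕ}
    (hp : Odd p) (hD : Nat.card D = 2) (hI : Nat.card I = p) (f : D ≃+ D) (e : I → D) :
    ∃ k < (p + 1) / 2, ∃ E : AffineMesh f e ≃ BinaryMesh.{u} p k,
      ∀ x y, E (x ◃ y) = E x ◃ E y := by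
  obtain ⟨ψ⟩ := nonempty_addEquiv_zmod Nat.prime_two hD
  have hf := addEquiv_eq_of_card_eq_two hD f
  have hsum := card_eq_zero_add_card_eq_one fun i => ψ (e i)
  have hdec : ∀ x y : ZMod 2, (x = 1 ↔ y = 1) → x = y := by decide
  have hdec' : ∀ x y : ZMod 2, (x = 0 ↔ y = 1) → y = 1 - x := by decide
  have hneg : ∀ x y : ZMod 2, 1 - x - (1 - y) = x - y := by decide
  have hcard : Nat.card I = Nat.card (ULift.{u} (Fin p)) := by simp [hI]
  rcases Nat.lt_or_ge (Nat.card {i // ψ (e i) = 1}) ((p + 1) / 2) with hlt | hge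
  · refine ⟨_, hlt, ?_⟩
    obtain ⟨σ, hσ⟩ := exists_equiv_iff_of_card_eq (fun i => ψ (e i) = 1)
      (fun i => initialShift.{u} p (Nat.card {i // ψ (e i) = 1}) i = 1) hcard
      (card_initialShift_eq_one (by omega)).symm
    refine AffineMesh.exists_equiv ψ σ 0 (fun a => by simp [hf]) fun i j => ?_
    rw [← hdec _ _ (hσ i), ← hdec _ _ (hσ j)]
    simp
  -- Complementing all shifts keeps their differences, so the smaller class can be taken as the
  -- shifted one.
  · have hlt : Nat.card {i // ψ (e i) = 0} < (p + 1) / 2 := by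
      obtain ⟨m, rfl⟩ := hp
      omega
    refine ⟨_, hlt, ?_⟩
    obtain ⟨σ, hσ⟩ := exists_equiv_iff_of_card_eq (fun i => ψ (e i) = 0)
      (fun i => initialShift.{u} p (Nat.card {i // ψ (e i) = 0}) i = 1) hcard
      (card_initialShift_eq_one (by omega)).symm
    refine AffineMesh.exists_equiv ψ σ 0 (fun a => by simp [hf]) fun i j => ?_
    rw [hdec' _ _ (hσ i), hdec' _ _ (hσ j), hneg]
    simp

theorem addEquiv_zmod_apply {n : ℕ} [NeZero n] (f : ZMod n ≃+ ZMod n) (x : ZMod n) :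
    f x = f 1 * x := by
  have h : x = x.val • (1 : ZMod n) := by simp
  conv_lhs => rw [h, map_nsmul]
  rw [nsmul_eq_mul, ZMod.natCast_val, ZMod.cast_id', id, mul_comm]

theorem exists_equiv_unitMesh {D : Type*} {I : Type u} [AddCommGroup D] [Finite I] {p : ℕ}
    (hp : p.Prime) (hD : Nat.card D = p) (hI : Nat.card I = 2) (f : D ≃+ D) (e : I → D)
    (hne : ¬ ((∀ a, f a = a) ∧ ∀ i j, e i = e j)) :
    ∃ a : (ZMod p)ˣ, ∃ E : AffineMesh f e ≃ UnitMesh.{u} p a,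
      ∀ x y, E (x ◃ y) = E x ◃ E y := by
  have : Fact p.Prime := ⟨hp⟩
  obtain ⟨ψ⟩ := nonempty_addEquiv_zmod hp hD
  obtain ⟨σ⟩ : Nonempty (I ≃ ULift.{u} Bool) := Finite.card_eq.1 (by simp [hI])
  set b : ZMod p := ψ (f (ψ.symm 1)) with hb
  have hfb (x : D) : ψ (f x) = b * ψ x := by
    simpa using addEquiv_zmod_apply (ψ.symm.trans (f.trans ψ)) (ψ x)
  have hb0 : b ≠ 0 := by simp [hb]
  refine ⟨Units.mk0 b hb0, ?_⟩
  by_cases hb1 : b = 1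
  · have hf : ∀ a, f a = a := fun a => ψ.injective (by rw [hfb, hb1, one_mul])
    set i₀ := σ.symm ⟨false⟩ with hi₀
    set i₁ := σ.symm ⟨true⟩ with hi₁
    have hI' : ∀ i, i = i₀ ∨ i = i₁ := by
      intro i
      rw [hi₀, hi₁, Equiv.eq_symm_apply, Equiv.eq_symm_apply]
      rcases σ i with ⟨_ | _⟩ <;> simp
    have hs : ψ (e i₁ - e i₀) ≠ 0 := by
      rw [Ne, EmbeddingLike.map_eq_zero_iff, sub_eq_zero]
      intro h
      refine hne ⟨hf, fun i j => ?_⟩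
      rcases hI' i with rfl | rfl <;> rcases hI' j with rfl | rfl <;> simp [h]
    -- For f = 1 the difference of the two shifts is nonzero and is rescaled to 1.
    refine AffineMesh.exists_equiv (ψ.trans (unitAut p (Units.mk0 _ hs)⁻¹)) σ 0
      (fun a => ?_) fun i j => ?_
    · simp [unitAut_apply, hfb]; ring
    · rcases hI' i with rfl | rfl <;> rcases hI' j with rfl | rfl <;>
        simp only [hi₀, hi₁, Equiv.apply_symm_apply] <;> simp only [← hi₀, ← hi₁] <;>
        simp [unitAut_apply, boolShift]
      · rw [← neg_sub (ψ (e i₁)), ← map_sub, mul_neg, inv_mul_cancel₀ hs]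
      · rw [← map_sub, inv_mul_cancel₀ hs]
  -- As 1 - b is invertible, new origins in the fibres realise any prescribed shifts.
  · have hb1' : 1 - b ≠ 0 := sub_ne_zero.2 (Ne.symm hb1)
    refine AffineMesh.exists_equiv ψ σ
      (fun i => ψ.symm ((1 - b)⁻¹ * (boolShift p (σ i) - ψ (e i)))) (fun a => ?_) fun i j => ?_
    · simp [unitAut_apply, hfb]
    · simp only [map_sub, map_add, hfb, AddEquiv.apply_symm_apply]
      field_simp
      ring

/-- The models of the quasi-affine quandles of order `2 * p`. -/
noncomputable def quasiAffineModel (p : ℕ) (hp : p.Prime) :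
    Fin ((p + 1) / 2) ⊕ (ZMod p)ˣ → QuasiAffineQuandle.{u} (2 * p)
  | .inl k => AffineMesh.toQuasiAffineQuandle (AddEquiv.refl (ZMod 2)) (initialShift.{u} p k)
      (by simp)
  | .inr a =>
    have : NeZero p := ⟨hp.ne_zero⟩
    AffineMesh.toQuasiAffineQuandle (unitAut p a) (boolShift.{u} p) (by simp [mul_comm])

theorem exists_quandleIsomorphic_quasiAffineModel {p : ℕ} (hp : p.Prime) (hp2 : 2 < p)
    (Q : QuasiAffineQuandle.{u} (2 * p)) :
    ∃ m, QuandleIsomorphic Q.carrier (quasiAffineModel.{u} p hp m).carrier := by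
  have hodd : Odd p := hp.odd_of_ne_two hp2.ne'
  have hpos := hp.pos
  have h2p : 0 < 2 * p := by positivity
  have hcard := Q.card_eq
  have : Nonempty Q.carrier := (Nat.card_pos_iff.1 (by rwa [hcard])).1
  obtain ⟨D, I, _, f, e, ⟨E, hE⟩, hI⟩ := Q.quasiAffine.exists_equiv_affineMesh
  have hQfin := Q.finite
  have hfinM : Finite (AffineMesh f e) := Finite.of_equiv _ E.symm
  have hDI : Nat.card D * Nat.card I = 2 * p := by
    rw [← AffineMesh.card_eq f e, Nat.card_congr E, hcard]
  have hIpos : Nat.card I ≠ 0 := fun h => by rw [h] at hDI; omega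
  have : Finite I := Nat.finite_of_card_ne_zero hIpos
  suffices h : ∃ m, ∃ F : AffineMesh f e ≃ (quasiAffineModel.{u} p hp m).carrier,
      ∀ x y, F (x ◃ y) = F x ◃ F y by
    obtain ⟨m, F, hF⟩ := h
    refine ⟨m, E.symm.trans F, fun x y => ?_⟩
    have : E.symm (x ◃ y) = E.symm x ◃ E.symm y := E.injective (by rw [hE]; simp)
    simp only [Equiv.trans_apply, this, hF]
  -- The decomposition does not record that `D` is generated by displacements, so a trivial action
  -- may also occur with |D| = p.
  have htriv (hf : ∀ a, f a = a) (he : ∀ i j, e i = e j) :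
      ∃ m, ∃ F : AffineMesh f e ≃ (quasiAffineModel.{u} p hp m).carrier,
        ∀ x y, F (x ◃ y) = F x ◃ F y := by
    refine ⟨.inl ⟨0, by omega⟩, ?_⟩
    have := (quasiAffineModel.{u} p hp (.inl ⟨0, by omega⟩)).finite
    refine exists_equiv_of_act_eq ?_ ?_ ?_
    · exact AffineMesh.act_eq hf he
    · exact AffineMesh.act_eq (fun _ => rfl) fun _ _ => by simp [initialShift]
    · rw [QuasiAffineQuandle.card_eq, Nat.card_congr E, hcard]
  have hdvd : Nat.card D ∣ 2 * p := ⟨_, hDI.symm⟩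
  obtain ⟨x, y, hx, hy, hxy⟩ := Nat.dvd_mul.1 hdvd
  rcases (Nat.dvd_prime Nat.prime_two).1 hx with rfl | rfl <;>
    rcases (Nat.dvd_prime hp).1 hy with rfl | rfl
  · have : Subsingleton D := (Nat.card_eq_one_iff_unique.1 hxy.symm).1
    exact htriv (fun _ => Subsingleton.elim _ _) fun _ _ => Subsingleton.elim _ _
  · rw [one_mul] at hxy
    have hI2 : Nat.card I = 2 := by
      rw [← hxy, mul_comm] at hDI
      exact Nat.eq_of_mul_eq_mul_right hpos hDI
    by_cases h : (∀ a, f a = a) ∧ ∀ i j, e i = e j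
    · exact htriv h.1 h.2
    · obtain ⟨a, F, hF⟩ := exists_equiv_unitMesh hp hxy.symm hI2 f e h
      exact ⟨.inr a, F, hF⟩
  · rw [mul_one] at hxy
    have hIp : Nat.card I = p := by
      rw [← hxy] at hDI
      exact Nat.eq_of_mul_eq_mul_left two_pos hDI
    obtain ⟨k, hk, F, hF⟩ := exists_equiv_binaryMesh hodd hxy.symm hIp f e
    exact ⟨.inl ⟨k, hk⟩, F, hF⟩
  · have hI1 : Nat.card I = 1 := by
      rw [← hxy] at hDI
      exact Nat.eq_of_mul_eq_mul_left h2p (by rw [hDI, mul_one])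
    exact absurd (hI (Nat.card_eq_one_iff_unique.1 hI1).1)
      (not_surjective_sub_of_card_eq_two_mul hp hp2 hxy.symm f)

/-! ### Invariants separating the models -/

section Invariants

open AffineMesh

/-- A point of fibre `i` translates fibre `j` by `e i - e j`, hence fixes all of it or none. -/
theorem card_fixed_mk {I : Type*} (e : I → ZMod 2) (a : ZMod 2) (i : I) :
    Nat.card {y // mk (AddEquiv.refl _) e a i ◃ y = y} = 2 * Nat.card {j // e j = e i} := by
  have h (y : ZMod 2 × I) : (mk (AddEquiv.refl _) e a i ◃ mk (AddEquiv.refl _) e y.1 y.2 =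
      mk (AddEquiv.refl _) e y.1 y.2) ↔ e y.2 = e i := by
    rw [mk_act_mk, mk_inj]
    simp [sub_eq_zero, add_sub_assoc, eq_comm]
  have E : {y // mk (AddEquiv.refl _) e a i ◃ y = y} ≃ ZMod 2 × {j // e j = e i} :=
    { toFun := fun y => (y.1.1, ⟨y.1.2, (h y.1).1 y.2⟩)
      invFun := fun y => ⟨mk _ _ y.1 y.2.1, (h (y.1, y.2.1)).2 y.2.2⟩
      left_inv := fun _ => rfl
      right_inv := fun _ => rfl }
  rw [Nat.card_congr E, Nat.card_prod, Nat.card_zmod]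

theorem binaryMesh_injective {p k l : ℕ} (hp : 0 < p) (hk : k < (p + 1) / 2) (hl : l < (p + 1) / 2)
    (E : BinaryMesh.{u} p k ≃ BinaryMesh.{u} p l) (hE : ∀ x y, E (x ◃ y) = E x ◃ E y) :
    k = l := by
  have hzero (m : ℕ) (hm : m ≤ p) :
      Nat.card {i : ULift.{u} (Fin p) // initialShift p m i = 0} = p - m := by
    have h := card_eq_zero_add_card_eq_one (initialShift.{u} p m)
    rw [card_initialShift_eq_one hm] at h
    simp only [Nat.card_eq_fintype_card, Fintype.card_ulift, Fintype.card_fin] at h ⊢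
    omega
  let i : ULift.{u} (Fin p) := ⟨⟨p - 1, by omega⟩⟩
  have hi : initialShift p k i = 0 := if_neg (by simp only [i]; omega)
  have h1 := card_fixed_mk (initialShift.{u} p k) 0 i
  rw [hi, hzero k (by omega)] at h1
  obtain ⟨⟨b, j⟩, hbj⟩ : ∃ y, y = E (mk _ _ 0 i) := ⟨_, rfl⟩
  have h2 := card_fixed_mk (initialShift.{u} p l) b j
  have h3 : Nat.card {y // mk (AddEquiv.refl _) (initialShift.{u} p k) 0 i ◃ y = y} =
      Nat.card {y // mk (AddEquiv.refl _) (initialShift.{u} p l) b j ◃ y = y} := by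
    refine Nat.card_congr (E.subtypeEquiv fun y => ?_)
    change _ ↔ mk _ _ b j ◃ E y = E y
    rw [show mk _ _ b j = E _ from hbj, ← hE, E.apply_eq_iff_eq]
  have hj : ∀ z : ZMod 2, z = 0 ∨ z = 1 := by decide
  -- The count 2(p - k) must be 2(p - l) or 2l; the latter fails because k + l < p.
  rcases hj (initialShift p l j) with h | h
  · rw [h, hzero l (by omega)] at h2
    omega
  · rw [h, card_initialShift_eq_one (by omega)] at h2
    omega

theorem iterate_act_invAct_of_equiv {Q R : Type*} [Quandle Q] [Quandle R] {E : Q ≃ R}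
    (hE : ∀ x y, E (x ◃ y) = E x ◃ E y) (x y z : Q) (n : ℕ) :
    E ((fun w => x ◃ (y ◃⁻¹ w))^[n] z) = (fun w => E x ◃ (E y ◃⁻¹ w))^[n] (E z) :=
  Function.Semiconj.iterate_right (f := E) (fun w => by rw [hE, map_invAct_of_equiv hE]) n z

/-- Displacements square to the identity over `ZMod 2`, but translation by 1 on `ZMod p` does not.
-/
theorem binaryMesh_not_equiv_unitMesh {p k : ℕ} (hp : 2 < p) (a : (ZMod p)ˣ)
    (E : BinaryMesh.{u} p k ≃ UnitMesh.{u} p a) (hE : ∀ x y, E (x ◃ y) = E x ◃ E y) : False := by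
  have h (x y z : BinaryMesh.{u} p k) : (fun w => x ◃ (y ◃⁻¹ w))^[2] z = z := by
    obtain ⟨a, i⟩ := x
    obtain ⟨b, j⟩ := y
    obtain ⟨c, l⟩ := z
    have h2 : ∀ c t : ZMod 2, c + 2 • t = c := by decide
    exact (iterate_act_invAct_mk _ _ a b c i j l 2).trans (congrArg (mk _ _ · l) (h2 _ _))
  have h' (x y z : UnitMesh.{u} p a) : (fun w => x ◃ (y ◃⁻¹ w))^[2] z = z := by
    obtain ⟨x, rfl⟩ := E.surjective x
    obtain ⟨y, rfl⟩ := E.surjective y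
    obtain ⟨z, rfl⟩ := E.surjective z
    rw [← iterate_act_invAct_of_equiv hE, h]
  have h1 := h' (mk _ _ 0 ⟨true⟩) (mk _ _ 0 ⟨false⟩) (mk _ _ 0 ⟨false⟩)
  rw [iterate_act_invAct_mk, mk_inj] at h1
  have h2 : ((2 : ℕ) : ZMod p) = 0 := by simpa [boolShift] using h1.1
  exact absurd (Nat.le_of_dvd two_pos ((ZMod.natCast_eq_zero_iff _ _).1 h2)) (by omega)

/-- Conjugating a displacement by any left translation raises it to the power `a`, and this identity
transfers along isomorphisms. -/
theorem unitMesh_injective {p : ℕ} [NeZero p] {a b : (ZMod p)ˣ}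
    (E : UnitMesh.{u} p a ≃ UnitMesh.{u} p b) (hE : ∀ x y, E (x ◃ y) = E x ◃ E y) : a = b := by
  have h (x y z w : UnitMesh.{u} p a) :
      z ◃ (x ◃ (y ◃⁻¹ w)) = (fun v => x ◃ (y ◃⁻¹ v))^[(a : ZMod p).val] (z ◃ w) := by
    obtain ⟨x, i⟩ := x
    obtain ⟨y, j⟩ := y
    obtain ⟨z, k⟩ := z
    obtain ⟨w, l⟩ := w
    change mk _ _ z k ◃ (mk _ _ x i ◃ (mk _ _ y j ◃⁻¹ mk _ _ w l)) =
      (fun v => mk _ _ x i ◃ (mk _ _ y j ◃⁻¹ v))^[(a : ZMod p).val] (mk _ _ z k ◃ mk _ _ w l)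
    rw [mk_act_mk_invAct_mk, mk_act_mk, mk_act_mk, iterate_act_invAct_mk, mk_inj]
    refine ⟨?_, rfl⟩
    simp only [nsmul_eq_mul, ZMod.natCast_val, ZMod.cast_id', id, unitAut_apply]
    ring
  have h' (x y z w : UnitMesh.{u} p b) :
      z ◃ (x ◃ (y ◃⁻¹ w)) = (fun v => x ◃ (y ◃⁻¹ v))^[(a : ZMod p).val] (z ◃ w) := by
    obtain ⟨x, rfl⟩ := E.surjective x
    obtain ⟨y, rfl⟩ := E.surjective y
    obtain ⟨z, rfl⟩ := E.surjective z
    obtain ⟨w, rfl⟩ := E.surjective w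
    rw [← hE z w, ← iterate_act_invAct_of_equiv hE, ← h, hE, hE, map_invAct_of_equiv hE]
  -- These points give translation by 1, so the identity reads b = a.
  have h1 := h' (mk _ _ 0 ⟨true⟩) (mk _ _ 0 ⟨false⟩) (mk _ _ 0 ⟨false⟩) (mk _ _ 0 ⟨false⟩)
  rw [mk_act_mk_invAct_mk, mk_act_mk, mk_act_mk, iterate_act_invAct_mk, mk_inj] at h1
  refine Units.ext ?_
  simpa [boolShift, unitAut_apply, eq_comm] using h1.1

end Invariants

theorem quasiAffineModel_injective {p : ℕ} (hp : p.Prime) (hp2 : 2 < p)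
    {m n : Fin ((p + 1) / 2) ⊕ (ZMod p)ˣ}
    (h : QuandleIsomorphic (quasiAffineModel.{u} p hp m).carrier
      (quasiAffineModel.{u} p hp n).carrier) : m = n := by
  have : NeZero p := ⟨hp.ne_zero⟩
  have h' := Setoid.symm' (QuasiAffineQuandle.isoSetoid.{u} (2 * p)) h
  obtain ⟨E, hE⟩ := h
  obtain ⟨E', hE'⟩ := h'
  rcases m with k | a <;> rcases n with l | b
  · exact congrArg Sum.inl (Fin.ext (binaryMesh_injective hp.pos k.2 l.2 E hE))
  · exact (binaryMesh_not_equiv_unitMesh hp2 b E hE).elim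
  · exact (binaryMesh_not_equiv_unitMesh hp2 a E' hE').elim
  · exact congrArg Sum.inr (unitMesh_injective E hE)

theorem mainTheorem9 (p : ℕ) (hp : p.Prime) (hp2 : 2 < p) :
    (Nat.card (QuasiAffineQuandle.IsoClass.{u} (2 * p)) : ℚ) = (3 * (p : ℚ) - 1) / 2 := by
  have : Fact p.Prime := ⟨hp⟩
  have hcard : Nat.card (Fin ((p + 1) / 2) ⊕ (ZMod p)ˣ) =
      Nat.card (QuasiAffineQuandle.IsoClass.{u} (2 * p)) := by
    refine Nat.card_eq_of_bijective
      (fun m => Quotient.mk (QuasiAffineQuandle.isoSetoid _) (quasiAffineModel.{u} p hp m)) ⟨?_, ?_⟩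
    · exact fun m n h => quasiAffineModel_injective hp hp2 (Quotient.exact h)
    · intro q
      induction q using Quotient.inductionOn with
      | h Q =>
        obtain ⟨m, hm⟩ := exists_quandleIsomorphic_quasiAffineModel hp hp2 Q
        exact ⟨m, (Quotient.sound hm).symm⟩
  rw [← hcard, Nat.card_sum, Nat.card_fin, Nat.card_eq_fintype_card, ZMod.card_units]
  obtain ⟨m, rfl⟩ := hp.odd_of_ne_two hp2.ne'
  rw [show (2 * m + 1 + 1) / 2 = m + 1 by omega, Nat.add_sub_cancel]
  push_cast
  ring
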